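/- Let $M$ be an oriented 3-manifold with toroidal boundary $\partial M = T_1\sqcup\dots\sqcup T_k$ (for example a hyperbolic one) and let $\mathcal T=\{\Delta_1,\dots,\Delta_n\}$ be an ideal triangulation of $M$; it has $n$ edges. For each $\Delta_j$ choose a pair of opposite edges; the shape parameter $z_j\in\mathbb C\setminus\{0,1\}$ is assigned to these two edges, and $z_j'=\frac1{1-z_j}$, $z_j''=1-\frac1{z_j}$ to the other two pairs of opposite edges, in the cyclic order given by the orientation. Let $E_{ij},E'_{ij},E''_{ij}$ be the numbers of edges of $\Delta_j$ with parameter $z_j,z_j',z_j''$ that are identified to the edge $e_i$ of $\mathcal T$. Fix $n-k$ edges $e_1,\dots,e_{n-k}$ whose edge equations are linearly independent, that is, such that the rows $(E_{ij}-E'_{ij},\,E''_{ij}-E'_{ij})_{1\le j\le n}$, $i\le n-k$, are linearly independent over $\mathbb Q$. The gluing variety is $$\mathcal V_{\mathcal T}=\Big\{\mathbf z\in(\mathbb C\setminus\{0,1\})^n:\ \prod_{j=1}^n z_j^{E_{ij}}(z_j')^{E'_{ij}}(z_j'')^{E''_{ij}}=1,\ i=1,\dots,n-k\Big\}.$$ A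 system of simple closed curves $\boldsymbol\alpha=(\alpha_1,\dots,\alpha_k)$ consists of one oriented, homotopically non-trivial simple closed curve $\alpha_i\subset T_i$ for each $i$, in normal position with respect to the triangulation of $T_i$ by the truncation triangles of the $\Delta_j$ (each arc cuts off one corner of a triangle). Let $C_{ij},C'_{ij},C''_{ij}$ be the number of corners with parameter $z_j,z_j',z_j''$ that $\alpha_i$ cuts off on its left minus the number of those on its right. Let $G,G',G''$ be the $n\times n$ matrices whose first $n-k$ rows are the rows of $E,E',E''$ of $e_1,\dots,e_{n-k}$ and whose last $k$ rows are those of $C,C',C''$. The holonomy of $\alpha_i$ is $\lambda_{\alpha_i}(\mathbf z)=\prod_j z_j^{C_{ij}}(z_j')^{C'_{ij}}(z_j'')^{C''_{ij}}$, and $\mathrm H(\alpha_i)$ denotes a holomorphic branch of $\log\lambda_{\alpha_i}$ near a given point. A strong combinatorial flattening consists of $\mathbf f,\mathbf f',\mathbf f''\in\mathbb Z^n$ with $f_j+f'_j+f''_j=1$ for all $j$ such that, for every system of simple closed curves, the first $n-k$ entries of $G\mathbf f+G'\mathbf f'+G''\mathbf f''$ are $2$ and the last $k$ are $0$. Fix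 one. The 1-loop invariant is the complex number, defined up to sign, $$\tau(M,\boldsymbol\alpha,\mathbf z,\mathcal T)=\pm\tfrac12\det\big((G-G')\Delta_{\mathbf z''}+(G''-G')\Delta_{\mathbf z}^{-1}\big)\prod_{j=1}^n z_j^{f_j''}(z_j'')^{-f_j},$$ where $\Delta_{\mathbf z}$ and $\Delta_{\mathbf z''}$ are the diagonal matrices with entries $z_j$ and $z_j''$. **Theorem.** Let $\mathbf z\in\mathcal V_{\mathcal T}$, and let $\boldsymbol\alpha,\boldsymbol\alpha'$ be two systems of simple closed curves on $\partial M$. Assume that $\tau(M,\boldsymbol\alpha,\mathbf z,\mathcal T)\ne0$. Then $\mathrm H(\alpha_1),\dots,\mathrm H(\alpha_k)$ are local holomorphic coordinates of $\mathcal V_{\mathcal T}$ at $\mathbf z$, and, with $\mathrm H(\alpha'_1),\dots,\mathrm H(\alpha'_k)$ regarded as functions of these coordinates near $\mathbf z$, $$\tau(M,\boldsymbol\alpha',\mathbf z,\mathcal T)=\pm\det\Big(\frac{\partial\mathrm H(\alpha'_i)}{\partial\mathrm H(\alpha_j)}\Big)_{ij}\,\tau(M,\boldsymbol\alpha,\mathbf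 z,\mathcal T),$$ where the Jacobian matrix is evaluated at $\mathbf z$, and both invariants are computed with the same quad types, the same edges $e_1,\dots,e_{n-k}$ and the same flattening. -/

import Mathlib

noncomputable section

namespace OneLoop

open Topology

/-- A gluing of `n` oriented tetrahedra with vertices `0, 1, 2, 3` along all of their faces.
Face `f` of a tetrahedron is the one opposite to its vertex `f`; face `f` of tetrahedron `t` is
glued to face `glue t f f` of tetrahedron `adj t f`, a vertex `v ≠ f` going to `glue t f v`.
Each tetrahedron is oriented by the order of its vertices, so that the gluing maps, extended
to the fourth vertex, are odd permutations. -/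
structure FaceGluing (n : ℕ) where
  adj : Fin n → Fin 4 → Fin n
  glue : Fin n → Fin 4 → Equiv.Perm (Fin 4)
  odd : ∀ t f, Equiv.Perm.sign (glue t f) = -1
  adj_adj : ∀ t f, adj (adj t f) (glue t f f) = t
  glue_glue : ∀ t f, glue (adj t f) (glue t f f) = (glue t f)⁻¹
  no_self : ∀ t f, ¬ (adj t f = t ∧ glue t f f = f)

/-- An edge of one of the tetrahedra: a tetrahedron with a two-element set of vertices. -/
abbrev TetEdge (n : ℕ) : Type := Fin n × {s : Finset (Fin 4) // s.card = 2}

namespace FaceGluing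

variable {n : ℕ}

/-- Two edges of tetrahedra are matched by the gluing of a face that contains the first one. -/
def EdgeStep (T : FaceGluing n) (x y : TetEdge n) : Prop :=
  ∃ f, f ∉ x.2.1 ∧ y.1 = T.adj x.1 f ∧ y.2.1 = x.2.1.image (T.glue x.1 f)

/-- The edges of the glued space. -/
def Edge (T : FaceGluing n) : Type := Quot T.EdgeStep

/-- The edge of the glued space that comes from an edge of a tetrahedron. -/
def edgeOf (T : FaceGluing n) (x : TetEdge n) : T.Edge := Quot.mk _ x

/-- The triangles of the boundary surface are the truncation triangles `(t, v)` at the vertices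
`v` of the tetrahedra `t`; two of them are adjacent if they are glued along a side. The sides
of `(t, v)` lie on the faces `f ≠ v` of `t`. -/
def TriangleStep (T : FaceGluing n) (x y : Fin n × Fin 4) : Prop :=
  ∃ f, f ≠ x.2 ∧ y = (T.adj x.1 f, T.glue x.1 f x.2)

/-- The ideal vertices of the glued space, i.e. the components of the boundary surface. -/
def Cusp (T : FaceGluing n) : Type := Quot T.TriangleStep

/-- The component of the boundary surface that contains the truncation triangle `(t, v)`. -/
def cuspOf (T : FaceGluing n) (t : Fin n) (v : Fin 4) : T.Cusp := Quot.mk _ (t, v)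

instance (T : FaceGluing n) : Finite T.Edge := inferInstanceAs (Finite (Quot T.EdgeStep))
instance (T : FaceGluing n) : Finite T.Cusp := inferInstanceAs (Finite (Quot T.TriangleStep))
instance (T : FaceGluing n) : Fintype T.Cusp := Fintype.ofFinite _
instance (T : FaceGluing n) : DecidableEq T.Edge := Classical.decEq _
instance (T : FaceGluing n) : DecidableEq T.Cusp := Classical.decEq _

/-- `(t, v, w)` with `v ≠ w` is the corner of the truncation triangle `(t, v)` on the edge `vw`
of `t`. Corners are matched when the faces containing them are glued. -/
def CornerStep (T : FaceGluing n) (x y : Fin n × Fin 4 × Fin 4) : Prop :=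
  ∃ f, f ≠ x.2.1 ∧ f ≠ x.2.2 ∧
    y = (T.adj x.1 f, T.glue x.1 f x.2.1, T.glue x.1 f x.2.2)

/-- `(t, v, f)` with `v ≠ f` is the side of the truncation triangle `(t, v)` on the face `f`
of `t`. -/
def SideStep (T : FaceGluing n) (x y : Fin n × Fin 4 × Fin 4) : Prop :=
  y = (T.adj x.1 x.2.2, T.glue x.1 x.2.2 x.2.1, T.glue x.1 x.2.2 x.2.2)

/-- The Euler characteristic of a component of the boundary surface: the number of its vertices
minus the number of its edges plus the number of its triangles. -/
def eulerChar (T : FaceGluing n) (c : T.Cusp) : ℤ :=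
  ((Quot.mk T.CornerStep '' {x | x.2.1 ≠ x.2.2 ∧ T.cuspOf x.1 x.2.1 = c}).ncard : ℤ)
    - ((Quot.mk T.SideStep '' {x | x.2.1 ≠ x.2.2 ∧ T.cuspOf x.1 x.2.1 = c}).ncard : ℤ)
    + ({x : Fin n × Fin 4 | T.cuspOf x.1 x.2 = c}.ncard : ℤ)

end FaceGluing

/-- An ideal triangulation, with `n` tetrahedra, of an oriented 3-manifold with toroidal
boundary. The boundary surface is closed and oriented, so its components are tori if and only
if they have Euler characteristic `0`. -/
structure IdealTriangulation (n : ℕ) extends FaceGluing n where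
  torus : ∀ c, toFaceGluing.eulerChar c = 0

/-! ### Simple closed curves on the boundary tori -/

/-- A closed oriented curve on the boundary surface, transverse to the sides of the truncation
triangles and cutting off one corner in each triangle that it passes through.
With `σ = flag i`, the `i`-th arc lies in the triangle at vertex `σ 0` of `tet i`, comes in
through the side on face `σ 2`, leaves through the side on face `σ 3`, and so cuts off the
corner on the edge from `σ 0` to `σ 1`. Indices are cyclic. -/
structure NormalCurve {n : ℕ} (T : FaceGluing n) where
  len : ℕ
  tet : Fin (len + 1) → Fin n
  flag : Fin (len + 1) → Equiv.Perm (Fin 4)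
  tet_succ : ∀ i, tet (i + 1) = T.adj (tet i) (flag i 3)
  vertex_succ : ∀ i, flag (i + 1) 0 = T.glue (tet i) (flag i 3) (flag i 0)
  side_succ : ∀ i, flag (i + 1) 2 = T.glue (tet i) (flag i 3) (flag i 3)

/-- The interior of the side, on face `f`, of the truncation triangle at vertex `v`, in
barycentric coordinates; the corner on the edge `vw` is the `w`-th unit vector. -/
def openSide (v f : Fin 4) : Set (Fin 4 → ℝ) :=
  {x | x v = 0 ∧ x f = 0 ∧ (∀ w, w ≠ v → w ≠ f → 0 < x w) ∧ ∑ w, x w = 1}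

namespace NormalCurve

variable {n : ℕ} {T : FaceGluing n}

/-- The curve is simple: its arcs can be realized by straight segments (from `P i` to `Q i`)
in the triangles, matching along the glued sides, in such a way that arcs in the same triangle
are disjoint. -/
def IsSimple (γ : NormalCurve T) : Prop :=
  ∃ P Q : Fin (γ.len + 1) → Fin 4 → ℝ,
    (∀ i, P i ∈ openSide (γ.flag i 0) (γ.flag i 2)) ∧
    (∀ i, Q i ∈ openSide (γ.flag i 0) (γ.flag i 3)) ∧
    (∀ i x, P (i + 1) (T.glue (γ.tet i) (γ.flag i 3) x) = Q i x) ∧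
    ∀ i j, i ≠ j → γ.tet i = γ.tet j → γ.flag i 0 = γ.flag j 0 →
      Disjoint (segment ℝ (P i) (Q i)) (segment ℝ (P j) (Q j))

/-- The number of times that the curve leaves the triangle `(t, v)` through its side on face
`f`, minus the number of times that it enters through this side. -/
def crossing (γ : NormalCurve T) (t : Fin n) (v f : Fin 4) : ℤ :=
  ((Finset.univ.filter fun i => γ.tet i = t ∧ γ.flag i 0 = v ∧ γ.flag i 3 = f).card : ℤ)
    - ((Finset.univ.filter fun i => γ.tet i = t ∧ γ.flag i 0 = v ∧ γ.flag i 2 = f).card : ℤ)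

/-- The curve bounds a 2-chain `∑ c D` of the cell decomposition dual to the triangulation of
the boundary surface, where `D` runs over the dual cells of the vertices: its net crossing
number with each oriented side is the difference of the values of `c` at the left and the right
end of this side. On a torus, a simple closed curve is homotopically trivial if and only if
it is null-homologous. -/
def IsNullHomologous (γ : NormalCurve T) : Prop :=
  ∃ c : Fin n → Fin 4 → Fin 4 → ℤ,
    (∀ t v w f, v ≠ w → f ≠ v → f ≠ w →
      c (T.adj t f) (T.glue t f v) (T.glue t f w) = c t v w) ∧
    ∀ t (σ : Equiv.Perm (Fin 4)), Equiv.Perm.sign σ = 1 →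
      γ.crossing t (σ 0) (σ 1) = c t (σ 0) (σ 3) - c t (σ 0) (σ 2)

end NormalCurve

/-- A system of simple closed curves: a homotopically non-trivial simple closed curve on each
boundary torus. -/
structure CurveSystem {n : ℕ} (T : FaceGluing n) where
  curve : T.Cusp → NormalCurve T
  mem_cusp : ∀ c i, T.cuspOf ((curve c).tet i) ((curve c).flag i 0) = c
  simple : ∀ c, (curve c).IsSimple
  nontrivial : ∀ c, ¬ (curve c).IsNullHomologous

/-! ### Shape parameters and Neumann-Zagier matrices -/

/-- `z, z' = 1 / (1 - z), z'' = 1 - 1 / z`. -/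
def shape (z : ℂ) : Fin 3 → ℂ := ![z, 1 / (1 - z), 1 - 1 / z]

/-- The quad types (pairs of opposite edges) of a tetrahedron, in the counterclockwise cyclic
order in which they are met around each truncated vertex, seen from that vertex. -/
def quadType (s : Finset (Fin 4)) : Fin 3 :=
  if s = {0, 1} ∨ s = {2, 3} then 0 else if s = {0, 2} ∨ s = {1, 3} then 1 else 2

/-- A choice `q` of quad types assigns `z t` to the edges of quad type `q t` of the tetrahedron
`t`, and then `z' t`, `z'' t` cyclically. `label q t s` is `0`, `1` or `2` according as the edge
`s` of `t` carries `z t`, `z' t` or `z'' t`. -/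
def label {n : ℕ} (q : Fin n → Fin 3) (t : Fin n) (s : Finset (Fin 4)) : Fin 3 :=
  quadType s - q t

section

variable {n : ℕ} (T : FaceGluing n) (q : Fin n → Fin 3)

/-- `E, E', E''` for `j = 0, 1, 2`: the number of edges of the tetrahedron `t` with label `j`
that are identified to the edge `e`. -/
def edgeCoeff (e : T.Edge) (j : Fin 3) (t : Fin n) : ℤ :=
  ((Finset.univ.filter fun s : {s : Finset (Fin 4) // s.card = 2} =>
    T.edgeOf (t, s) = e ∧ label q t s.1 = j).card : ℤ)

variable {T} in
/-- `C, C', C''` for `j = 0, 1, 2`: the number of corners of the tetrahedron `t` with label `j`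
that the curve cuts off on its left hand side, minus the number of those on its right.
The corner cut off by an arc with flag `σ` is on the right if and only if `σ` is even. -/
def curveCoeff (γ : NormalCurve T) (j : Fin 3) (t : Fin n) : ℤ :=
  ∑ i, if γ.tet i = t ∧ label q t {γ.flag i 0, γ.flag i 1} = j
    then -((Equiv.Perm.sign (γ.flag i) : ℤˣ) : ℤ) else 0

/-- `S` consists of `n - k` edges with linearly independent edge equations, where `k` is the
number of boundary tori. As `log z + log z' + log z''` is constant, the edge equation of `e` is
a linear equation in the `log z t`, `log z'' t` with coefficients `E - E'` and `E'' - E'`. -/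
def IsEdgeBasis (S : Finset T.Edge) : Prop :=
  S.card + Fintype.card T.Cusp = n ∧
  LinearIndependent ℚ fun (e : S) (x : Fin n × Bool) =>
    (((if x.2 then edgeCoeff T q e 0 x.1 else edgeCoeff T q e 2 x.1)
      - edgeCoeff T q e 1 x.1 : ℤ) : ℚ)

/-- The gluing variety, in the coordinates `z = (z_1, ..., z_n)`: the shape parameters differ
from `0` and `1` and satisfy the edge equations of the edges in `S`. -/
def gluingVariety (S : Finset T.Edge) : Set (Fin n → ℂ) :=
  {z | (∀ t, z t ≠ 0 ∧ z t ≠ 1) ∧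
    ∀ e ∈ S, ∏ t, ∏ j, shape (z t) j ^ edgeCoeff T q e j t = 1}

variable {T}

/-- The matrices `G, G', G''` for `j = 0, 1, 2`. The rows are indexed by the edges in `S`,
followed by the boundary tori. -/
def gluingMatrix (S : Finset T.Edge) (α : CurveSystem T) (j : Fin 3) :
    Matrix (S ⊕ T.Cusp) (Fin n) ℤ :=
  Matrix.of (Sum.elim (fun e => edgeCoeff T q e j) fun c => curveCoeff q (α.curve c) j)

/-- `f 0, f 1, f 2` form a strong combinatorial flattening `(f, f', f'')`. -/
def IsStrongFlattening (S : Finset T.Edge) (f : Fin 3 → Fin n → ℤ) : Prop :=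
  (∀ t, f 0 t + f 1 t + f 2 t = 1) ∧
  ∀ α : CurveSystem T,
    ∑ j, (gluingMatrix q S α j).mulVec (f j) = Sum.elim (fun _ => 2) fun _ => 0

/-- The 1-loop invariant, which is well-defined only up to sign: `r` is a numbering of the rows
of the matrices `G, G', G''`, which makes them square matrices, and which affects the sign. -/
def oneLoop (S : Finset T.Edge) (f : Fin 3 → Fin n → ℤ) (r : Fin n ≃ S ⊕ T.Cusp)
    (α : CurveSystem T) (z : Fin n → ℂ) : ℂ :=
  let G : Fin 3 → Matrix (Fin n) (Fin n) ℂ := fun j =>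
    ((gluingMatrix q S α j).map (Int.cast : ℤ → ℂ)).submatrix r id
  1 / 2 * ((G 0 - G 1) * Matrix.diagonal (fun t => shape (z t) 2)
      + (G 2 - G 1) * (Matrix.diagonal z)⁻¹).det
    * ∏ t, (z t ^ f 2 t * shape (z t) 2 ^ (-f 0 t))

/-! ### Holonomies -/

/-- The holonomy `λ` of the `c`-th curve of the system, as a function of the shapes. -/
def holonomy (α : CurveSystem T) (c : T.Cusp) (z : Fin n → ℂ) : ℂ :=
  ∏ t, ∏ j, shape (z t) j ^ curveCoeff q (α.curve c) j t

/-- `H = (H(α_1), ..., H(α_k))` is a holomorphic choice of the logarithmic holonomies of the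
curves in `α` near the point `z`: `exp H(α_c)` is the holonomy of `α_c`. -/
def IsLogHolonomy (α : CurveSystem T) (z : Fin n → ℂ) (H : (Fin n → ℂ) → T.Cusp → ℂ) : Prop :=
  ∀ᶠ w in 𝓝 z, DifferentiableAt ℂ H w ∧ ∀ c, Complex.exp (H w c) = holonomy q α c w

/-- `ζ` expresses the points near `z` of the gluing variety as a holomorphic function of
`H = (H(α_1), ..., H(α_k))`, i.e. the `H(α_c)` are local holomorphic coordinates of the gluing
variety at `z`, and `ζ` is the inverse of this chart. -/
structure IsHolonomyChart (S : Finset T.Edge) (z : Fin n → ℂ) (H : (Fin n → ℂ) → T.Cusp → ℂ)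
    (ζ : (T.Cusp → ℂ) → Fin n → ℂ) : Prop where
  base : ζ (H z) = z
  holomorphic : ∀ᶠ u in 𝓝 (H z), DifferentiableAt ℂ ζ u
  mem : ∀ᶠ u in 𝓝 (H z), ζ u ∈ gluingVariety T q S
  right_inv : ∀ᶠ u in 𝓝 (H z), H (ζ u) = u
  left_inv : ∀ᶠ w in 𝓝[gluingVariety T q S] z, ζ (H w) = w

end

/-- The matrix `(∂ H'_i / ∂ H_j)` at the point `z`, where the `H'_i` are viewed as functions of
the coordinates `H_j` by means of the inverse chart `ζ`. -/
def holonomyJacobian {n : ℕ} {ι : Type*} [Fintype ι] [DecidableEq ι] (z : Fin n → ℂ)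
    (H H' : (Fin n → ℂ) → ι → ℂ) (ζ : (ι → ℂ) → Fin n → ℂ) : Matrix ι ι ℂ :=
  Matrix.of fun i j => fderiv ℂ (fun u => H' (ζ u) i) (H z) (Pi.single j 1)

end OneLoop

end

/-! Let `F` collect the logarithms of the `n - k` edge monomials and of the `k` holonomies of `α`,
normalized to vanish at `z`, and let `D` be its Jacobian matrix there. The logarithmic derivatives
of `z, z', z''` add up to `0`, so `G'` can be eliminated from `D`; multiplying column `t` by `z t -
1` then gives the matrix in the 1-loop invariant. Hence the invariant is `det D` times a factor
independent of the curves (`oneLoop_eq`).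

If it is nonzero, `F` is a local biholomorphism. Near `z` the gluing variety is the zero set of the
edge components of `F`, so the remaining components, which are the `H(α_c)` up to constants, are
coordinates on it (`exists_isHolonomyChart`).

Let `Z` be the derivative of the inverse chart and `D'` the analogue of `D` for `α'`. Then `D Z =
(0; 1)` and `D' Z = (0; J)` with `J` the holonomy Jacobian, and the edge rows of `D` and `D'` agree.
So `D' D⁻¹` is block lower triangular with diagonal blocks `1` and `J`, and `det D' = det J * det D`
(`det_submatrix_eq_of_mul_eq`). -/

namespace OneLoop

open Topology Filter

/-! ### Logarithms of monomials in the shape parameters -/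

/-- The logarithmic derivatives of the three shape parameters. -/
noncomputable def shapeLogDeriv (z : ℂ) : Fin 3 → ℂ := ![1 / z, 1 / (1 - z), 1 / (z * (z - 1))]

theorem shape_ne_zero {z : ℂ} (h : z ≠ 0 ∧ z ≠ 1) (j : Fin 3) : shape z j ≠ 0 := by
  have h1 : 1 - z ≠ 0 := sub_ne_zero.2 h.2.symm
  have h2 : 1 - 1 / z ≠ 0 := by
    rw [one_sub_div h.1]
    exact div_ne_zero (sub_ne_zero.2 h.2) h.1
  fin_cases j
  · exact h.1
  · exact one_div_ne_zero h1
  · exact h2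

theorem hasDerivAt_shape {z : ℂ} (h : z ≠ 0 ∧ z ≠ 1) (j : Fin 3) :
    HasDerivAt (fun w => shape w j) (shape z j * shapeLogDeriv z j) z := by
  have h1 : 1 - z ≠ 0 := sub_ne_zero.2 h.2.symm
  have h2 : z - 1 ≠ 0 := sub_ne_zero.2 h.2
  have h0 := h.1
  fin_cases j
  · refine (hasDerivAt_id' z).congr_deriv ?_
    simp [shape, shapeLogDeriv, h0]
  · have := ((hasDerivAt_id z).const_sub 1).inv h1
    simp only [shape, shapeLogDeriv, one_div]
    refine this.congr_deriv ?_
    simp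
    field_simp
  · have := (hasDerivAt_inv h0).const_sub 1
    simp only [shape, shapeLogDeriv, one_div]
    refine this.congr_deriv ?_
    simp
    field_simp

theorem contDiffAt_shape {z : ℂ} (h : z ≠ 0 ∧ z ≠ 1) (j : Fin 3) :
    ContDiffAt ℂ 1 (fun w => shape w j) z := by
  have h1 : 1 - z ≠ 0 := sub_ne_zero.2 h.2.symm
  have h0 := h.1
  fin_cases j
  · exact contDiffAt_id
  · exact contDiffAt_const.div (contDiffAt_const.sub contDiffAt_id) h1
  · exact contDiffAt_const.sub (contDiffAt_const.div contDiffAt_id h0)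

section

variable {n : ℕ} {ι : Type*}

/-- The monomials in the shape parameters with exponents `a`. -/
noncomputable def monomial (a : Fin 3 → Matrix ι (Fin n) ℤ) (w : Fin n → ℂ) (i : ι) : ℂ :=
  ∏ t, ∏ j, shape (w t) j ^ a j i t

/-- The logarithms of the monomials with exponents `a`, normalized to vanish at `z`. -/
noncomputable def logMonomial (a : Fin 3 → Matrix ι (Fin n) ℤ) (z w : Fin n → ℂ) (i : ι) : ℂ :=
  ∑ t, ∑ j, (a j i t : ℂ) * Complex.log (shape (w t) j / shape (z t) j)

/-- The Jacobian matrix at `z` of the logarithms of the monomials with exponents `a`. -/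
noncomputable def logJacobian (a : Fin 3 → Matrix ι (Fin n) ℤ) (z : Fin n → ℂ) : Matrix ι (Fin n) ℂ :=
  Matrix.of fun i t => ∑ j, (a j i t : ℂ) * shapeLogDeriv (z t) j

variable (a : Fin 3 → Matrix ι (Fin n) ℤ) {z : Fin n → ℂ}

theorem logMonomial_self (hz : ∀ t, z t ≠ 0 ∧ z t ≠ 1) : logMonomial a z z = 0 := by
  funext i
  simp [logMonomial, div_self (shape_ne_zero (hz _) _)]

theorem monomial_ne_zero (hz : ∀ t, z t ≠ 0 ∧ z t ≠ 1) (i : ι) : monomial a z i ≠ 0 :=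
  Finset.prod_ne_zero_iff.2 fun t _ => Finset.prod_ne_zero_iff.2 fun j _ =>
    zpow_ne_zero _ (shape_ne_zero (hz t) j)

theorem eventually_ne (hz : ∀ t, z t ≠ 0 ∧ z t ≠ 1) :
    ∀ᶠ w in 𝓝 z, ∀ t, w t ≠ 0 ∧ w t ≠ 1 :=
  eventually_all.2 fun t =>
    ((continuous_apply t).continuousAt.eventually_ne (hz t).1).and
      ((continuous_apply t).continuousAt.eventually_ne (hz t).2)

theorem exp_logMonomial {w : Fin n → ℂ} (hz : ∀ t, z t ≠ 0 ∧ z t ≠ 1)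
    (hw : ∀ t, w t ≠ 0 ∧ w t ≠ 1) (i : ι) :
    Complex.exp (logMonomial a z w i) = monomial a w i / monomial a z i := by
  simp only [logMonomial, monomial, Complex.exp_sum, ← Finset.prod_div_distrib]
  refine Finset.prod_congr rfl fun t _ => Finset.prod_congr rfl fun j _ => ?_
  rw [Complex.exp_int_mul, Complex.exp_log, div_zpow]
  exact div_ne_zero (shape_ne_zero (hw t) j) (shape_ne_zero (hz t) j)

theorem contDiffAt_logMonomial [Fintype ι] (hz : ∀ t, z t ≠ 0 ∧ z t ≠ 1) :
    ContDiffAt ℂ 1 (logMonomial a z) z := by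
  refine contDiffAt_pi.2 fun i => ContDiffAt.sum fun t _ => ContDiffAt.sum fun j _ =>
    contDiffAt_const.mul ((Complex.contDiffAt_log ?_).comp (f := fun w : Fin n → ℂ =>
      shape (w t) j / shape (z t) j) z ?_)
  -- Dividing by the value at `z` puts the argument of the logarithm at `1`, away from the branch
  -- cut.
  · simp [div_self (shape_ne_zero (hz t) j)]
  · exact (ContDiffAt.comp (g := fun x => shape x j) (f := fun w : Fin n → ℂ => w t) z
      (contDiffAt_shape (hz t) j) (contDiff_apply ℂ ℂ t).contDiffAt).div_const _

theorem hasFDerivAt_logMonomial [Fintype ι] (hz : ∀ t, z t ≠ 0 ∧ z t ≠ 1) :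
    HasFDerivAt (logMonomial a z)
      (LinearMap.toContinuousLinearMap (logJacobian a z).mulVecLin) z := by
  refine hasFDerivAt_pi'.2 fun i => ?_
  have key (t : Fin n) (j : Fin 3) : HasFDerivAt (fun w : Fin n → ℂ =>
      (a j i t : ℂ) * Complex.log (shape (w t) j / shape (z t) j))
      ((a j i t : ℂ) • shapeLogDeriv (z t) j •
        (ContinuousLinearMap.proj t : (Fin n → ℂ) →L[ℂ] ℂ)) z := by
    have hs := shape_ne_zero (hz t) j
    have h1 : HasDerivAt (fun x => Complex.log (shape x j / shape (z t) j))
        (shapeLogDeriv (z t) j) (z t) := by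
      refine (((hasDerivAt_shape (hz t) j).div_const (shape (z t) j)).clog
        (by simp [div_self hs])).congr_deriv ?_
      field_simp
    exact (h1.comp_hasFDerivAt z (hasFDerivAt_apply (𝕜 := ℂ) (F' := fun _ : Fin n => ℂ) t z)).const_mul _
  refine (HasFDerivAt.fun_sum fun t _ => HasFDerivAt.fun_sum fun j _ => key t j).congr_fderiv ?_
  ext v
  simp [logJacobian, Matrix.mulVec, dotProduct, Finset.sum_mul, mul_assoc]

end

/-! ### Comparison of logarithms -/

/-- Both functions eventually have imaginary part in `(-π, π)`, where `exp` is injective. The filter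
is arbitrary because both full neighbourhoods and neighbourhoods within the gluing variety are
needed. -/
theorem eventuallyEq_of_exp_eq {X : Type*} {l : Filter X} {f g : X → ℂ}
    (hf : Tendsto f l (𝓝 0)) (hg : Tendsto g l (𝓝 0))
    (h : ∀ᶠ x in l, Complex.exp (f x) = Complex.exp (g x)) : f =ᶠ[l] g := by
  have hlog : ∀ {f : X → ℂ}, Tendsto f l (𝓝 0) →
      ∀ᶠ x in l, Complex.log (Complex.exp (f x)) = f x := by
    intro f hf
    have him : Tendsto (fun x => (f x).im) l (𝓝 0) := by
      exact (Complex.continuous_im.tendsto 0).comp hf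
    filter_upwards [him.eventually (Ioo_mem_nhds (neg_lt_zero.2 Real.pi_pos) Real.pi_pos)]
      with x hx
    exact Complex.log_exp hx.1 hx.2.le
  filter_upwards [h, hlog hf, hlog hg] with x h1 h2 h3
  rw [← h2, ← h3, h1]

theorem exists_local_inverse {E G : Type*} [NormedAddCommGroup E] [NormedSpace ℂ E]
    [CompleteSpace E] [NormedAddCommGroup G] [NormedSpace ℂ G] {F : E → G} {L : E ≃L[ℂ] G}
    {z : E} (hF : ContDiffAt ℂ 1 F z) (hL : HasFDerivAt F (L : E →L[ℂ] G) z) :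
    ∃ g : G → E, ContDiffAt ℂ 1 g (F z) ∧ g (F z) = z ∧
      (∀ᶠ y in 𝓝 (F z), F (g y) = y) ∧ ∀ᶠ x in 𝓝 z, g (F x) = x := by
  have hs := hF.hasStrictFDerivAt' hL one_ne_zero
  exact ⟨hF.localInverse hL one_ne_zero, hF.to_localInverse hL one_ne_zero,
    hF.localInverse_apply_image hL one_ne_zero, hs.eventually_right_inverse,
    hs.eventually_left_inverse⟩

/-! ### Determinants -/

section

variable {m ι κ : Type*} [Fintype m] [DecidableEq m] [Fintype ι] [DecidableEq ι] [Fintype κ]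
  [DecidableEq κ]

/-- Rows and columns have different index types, so the inverse is taken after renumbering by `r`,
which is then undone on the columns of the inverse. -/
theorem exists_inverse_of_det_submatrix_ne_zero (D : Matrix ι m ℂ) (r : m ≃ ι)
    (h : (D.submatrix r id).det ≠ 0) : ∃ B : Matrix m ι ℂ, D * B = 1 ∧ B * D = 1 := by
  have hu : IsUnit (D.submatrix r id).det := isUnit_iff_ne_zero.2 h
  have hD : D = (D.submatrix r id).submatrix r.symm id := by
    ext i j
    simp
  refine ⟨(D.submatrix r id)⁻¹.submatrix id r.symm, ?_, ?_⟩
  · nth_rewrite 1 [hD]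
    rw [← Matrix.submatrix_mul _ _ _ _ _ Function.bijective_id, Matrix.mul_nonsing_inv _ hu,
      Matrix.submatrix_one_equiv]
  · nth_rewrite 2 [hD]
    rw [Matrix.submatrix_mul_equiv]
    simp [Matrix.nonsing_inv_mul _ hu]

/-- If `D` and `D'` agree on the rows in `ι`, and the columns of `Z` are mapped by `D` to the
unit vectors in `κ`, then the quotient of the determinants of `D'` and `D` is the determinant
of the `κ`-part of `D' * Z`. -/
theorem det_submatrix_eq_of_mul_eq {D D' : Matrix (ι ⊕ κ) m ℂ} {Z : Matrix m κ ℂ}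
    {J : Matrix κ κ ℂ} (r : m ≃ ι ⊕ κ) (h : (D.submatrix r id).det ≠ 0)
    (hrow : ∀ i, D' (Sum.inl i) = D (Sum.inl i))
    (hZ : D * Z = Matrix.fromRows (0 : Matrix ι κ ℂ) (1 : Matrix κ κ ℂ))
    (hJ : ∀ i j, (D' * Z) (Sum.inr i) j = J i j) :
    (D'.submatrix r id).det = J.det * (D.submatrix r id).det := by
  obtain ⟨B, hDB, hBD⟩ := exists_inverse_of_det_submatrix_ne_zero D r h
  have hZB : Z = B * Matrix.fromRows (0 : Matrix ι κ ℂ) (1 : Matrix κ κ ℂ) := by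
    rw [← hZ, ← Matrix.mul_assoc, hBD, Matrix.one_mul]
  -- As `Z = B * (0; 1)`, the `κ`-columns of `B = D⁻¹` are those of `Z`.
  have hcol (i j) : (D' * B) i (Sum.inr j) = (D' * Z) i j := by
    rw [hZB, ← Matrix.mul_assoc, Matrix.mul_apply (M := D' * B), Fintype.sum_sum_type]
    simp [Matrix.one_apply]
  -- On the rows in `ι`, `D' * B` coincides with `D * B = 1`; the lower left block does not affect
  -- the determinant.
  have hblock : D' * B = Matrix.fromBlocks 1 0 (D' * B).toBlocks₂₁ J := by
    have hl (i j) : (D' * B) (Sum.inl i) j = (1 : Matrix (ι ⊕ κ) (ι ⊕ κ) ℂ) (Sum.inl i) j := by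
      rw [← hDB, Matrix.mul_apply, Matrix.mul_apply, hrow]
    ext (i | i) (j | j)
    · simp [hl, Matrix.one_apply]
    · simp [hl]
    · rfl
    · rw [hcol, hJ]
      rfl
  have hD' : D'.submatrix r id = (D' * B).submatrix r r * D.submatrix r id := by
    rw [Matrix.submatrix_mul_equiv, Matrix.mul_assoc, hBD, Matrix.mul_one]
  rw [hD', Matrix.det_mul, Matrix.det_submatrix_equiv_self, hblock, Matrix.det_fromBlocks_zero₁₂,
    Matrix.det_one, one_mul]

-- Two numberings of the rows differ by a permutation; this is the source of the sign ambiguity.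
omit [Fintype ι] [DecidableEq ι] in
theorem det_submatrix_eq_or_eq_neg (D : Matrix ι m ℂ) (r r' : m ≃ ι) :
    (D.submatrix r' id).det = (D.submatrix r id).det ∨
      (D.submatrix r' id).det = -(D.submatrix r id).det := by
  have h := Matrix.det_permute (r'.trans r.symm) (D.submatrix r id)
  rw [Matrix.submatrix_submatrix] at h
  have he : (r : m → ι) ∘ (r'.trans r.symm) = r' := by
    funext x
    simp
  rw [he, Function.id_comp] at h
  rcases Int.units_eq_one_or (Equiv.Perm.sign (r'.trans r.symm)) with hs | hs
  · left
    simpa [hs] using h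
  · right
    simpa [hs] using h

end

/-! ### Holonomies as coordinates -/

section

variable {n : ℕ} {T : FaceGluing n} {q : Fin n → Fin 3} {S : Finset T.Edge}

/-- The 1-loop invariant is, up to a factor that does not depend on the curves, the Jacobian
determinant of the logarithms of the edge equations and holonomies. -/
theorem oneLoop_eq (f : Fin 3 → Fin n → ℤ) (r : Fin n ≃ S ⊕ T.Cusp) (α : CurveSystem T)
    {z : Fin n → ℂ} (hz : ∀ t, z t ≠ 0 ∧ z t ≠ 1) :
    oneLoop q S f r α z = ((logJacobian (gluingMatrix q S α) z).submatrix r id).det *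
      (1 / 2 * (∏ t, (z t - 1)) * ∏ t, (z t ^ f 2 t * shape (z t) 2 ^ (-f 0 t))) := by
  have hinv : (Matrix.diagonal z)⁻¹ = Matrix.diagonal fun t => (z t)⁻¹ := by
    refine Matrix.inv_eq_right_inv ?_
    simp [Matrix.diagonal_mul_diagonal, mul_inv_cancel₀ (hz _).1]
  -- Since `1/z + 1/(1-z) + 1/(z(z-1)) = 0`, only `G 0 - G 1` and `G 2 - G 1` survive, with
  -- coefficients `1/z` and `1/(z(z-1))`; times `z - 1` these become `z''` and `1/z`.
  have hmat : ∀ G : Fin 3 → Matrix (Fin n) (Fin n) ℂ,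
      G = (fun j => ((gluingMatrix q S α j).map (Int.cast : ℤ → ℂ)).submatrix r id) →
      (G 0 - G 1) * Matrix.diagonal (fun t => shape (z t) 2)
        + (G 2 - G 1) * (Matrix.diagonal z)⁻¹ =
      (logJacobian (gluingMatrix q S α) z).submatrix r id
        * Matrix.diagonal fun t => z t - 1 := by
    rintro G rfl
    rw [hinv]
    ext i t
    have h0 := (hz t).1
    have h1 : 1 - z t ≠ 0 := sub_ne_zero.2 (hz t).2.symm
    have h2 : z t - 1 ≠ 0 := sub_ne_zero.2 (hz t).2
    simp only [Matrix.add_apply, Matrix.mul_diagonal, Matrix.sub_apply, Matrix.submatrix_apply,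
      Matrix.map_apply, id, logJacobian, Matrix.of_apply, Fin.sum_univ_three, shape,
      shapeLogDeriv, Matrix.cons_val]
    rw [← neg_sub (z t) 1]
    field_simp
    ring
  simp only [oneLoop]
  rw [hmat _ rfl, Matrix.det_mul, Matrix.det_diagonal]
  ring

theorem monomial_inr (α : CurveSystem T) (w : Fin n → ℂ) (c : T.Cusp) :
    monomial (gluingMatrix q S α) w (Sum.inr c) = holonomy q α c w := rfl

theorem monomial_inl (α : CurveSystem T) {w : Fin n → ℂ} (hw : w ∈ gluingVariety T q S) (e : S) :
    monomial (gluingMatrix q S α) w (Sum.inl e) = 1 := hw.2 e e.2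

variable {z : Fin n → ℂ} {α : CurveSystem T} {H : (Fin n → ℂ) → T.Cusp → ℂ}

/-- Two logarithms of the same holonomy differ by a constant. -/
theorem IsLogHolonomy.eventually_eq (hz : ∀ t, z t ≠ 0 ∧ z t ≠ 1) (hH : IsLogHolonomy q α z H) :
    ∀ᶠ w in 𝓝 z, ∀ c,
      logMonomial (gluingMatrix q S α) z w (Sum.inr c) = H w c - H z c := by
  refine eventually_all.2 fun c => ?_
  have hHc : ContinuousAt (fun w => H w c) z :=
    continuousAt_pi.1 hH.self_of_nhds.1.continuousAt c
  have hF : ContinuousAt (fun w => logMonomial (gluingMatrix q S α) z w (Sum.inr c)) z :=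
    continuousAt_pi.1 (contDiffAt_logMonomial _ hz).continuousAt (Sum.inr c)
  refine eventuallyEq_of_exp_eq ?_ ?_ ?_
  · simpa [ContinuousAt, logMonomial_self _ hz] using hF
  · simpa using hHc.sub_const (H z c)
  · filter_upwards [hH, eventually_ne hz] with w hw hw0
    rw [exp_logMonomial _ hz hw0, Complex.exp_sub, hw.2, hH.self_of_nhds.2, monomial_inr,
      monomial_inr]

/-- An edge equation determines the logarithm only modulo `2πi`, but the branch used here is
continuous and vanishes at `z`. -/
theorem eventually_logMonomial_inl_eq_zero (hz : z ∈ gluingVariety T q S) (α : CurveSystem T) :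
    ∀ᶠ w in 𝓝[gluingVariety T q S] z, ∀ e,
      logMonomial (gluingMatrix q S α) z w (Sum.inl e) = 0 := by
  refine eventually_all.2 fun e => ?_
  have hF : ContinuousAt (fun w => logMonomial (gluingMatrix q S α) z w (Sum.inl e)) z :=
    continuousAt_pi.1 (contDiffAt_logMonomial _ hz.1).continuousAt (Sum.inl e)
  refine eventuallyEq_of_exp_eq (g := fun _ => 0) ?_ tendsto_const_nhds ?_
  · have := hF.continuousWithinAt (s := gluingVariety T q S)
    simpa [ContinuousWithinAt, logMonomial_self _ hz.1] using this
  · filter_upwards [self_mem_nhdsWithin] with w hw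
    rw [exp_logMonomial _ hz.1 hw.1, monomial_inl α hw, monomial_inl α hz]
    simp

theorem exists_isHolonomyChart (hz : z ∈ gluingVariety T q S) (hH : IsLogHolonomy q α z H)
    {B : Matrix (Fin n) (S ⊕ T.Cusp) ℂ} (hDB : logJacobian (gluingMatrix q S α) z * B = 1)
    (hBD : B * logJacobian (gluingMatrix q S α) z = 1) : ∃ ζ, IsHolonomyChart q S z H ζ := by
  obtain ⟨g, hg, hgz, hr, hl⟩ := exists_local_inverse
    (L := (Matrix.toLin'OfInv hBD hDB).toContinuousLinearEquiv)
    (contDiffAt_logMonomial (gluingMatrix q S α) hz.1)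
    (hasFDerivAt_logMonomial (gluingMatrix q S α) hz.1)
  have hF0 := logMonomial_self (gluingMatrix q S α) hz.1
  -- The chart is the local inverse restricted to the slice where the edge logarithms vanish. The
  -- shift by `H z` reflects that `logMonomial` is `0` at `z` whereas `H` need not be.
  let i : (T.Cusp → ℂ) → S ⊕ T.Cusp → ℂ := fun u => Sum.elim 0 (u - H z)
  have hi : Differentiable ℂ i := by
    refine differentiable_pi.2 fun s => ?_
    rcases s with e | c
    · exact differentiable_const _
    · exact (differentiable_apply c).sub_const _
  have hiz : i (H z) = logMonomial (gluingMatrix q S α) z z := by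
    rw [hF0]
    funext s
    rcases s with e | c <;> simp [i]
  have hit : Tendsto i (𝓝 (H z)) (𝓝 (logMonomial (gluingMatrix q S α) z z)) :=
    hiz ▸ hi.continuous.continuousAt
  have hζ : Tendsto (fun u => g (i u)) (𝓝 (H z)) (𝓝 z) := by
    have := hg.continuousAt.tendsto.comp hit
    rwa [hgz] at this
  refine ⟨fun u => g (i u), ⟨by rw [hiz, hgz], ?_, ?_, ?_, ?_⟩⟩
  -- Being `C¹` at a point extends to a neighbourhood, as the order is finite.
  · filter_upwards [hit.eventually (hg.eventually (by simp))] with u hu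
    exact (hu.differentiableAt one_ne_zero).comp u (hi u)
  · filter_upwards [hit.eventually hr, hζ.eventually (eventually_ne hz.1)] with u hu hu0
    refine ⟨hu0, fun e he => ?_⟩
    -- Exponentiating the vanishing edge logarithm recovers the edge equation.
    have h := exp_logMonomial (gluingMatrix q S α) hz.1 hu0 (Sum.inl ⟨e, he⟩)
    rw [hu, monomial_inl α hz, div_one] at h
    refine Eq.trans h.symm ?_
    simp [i]
  · filter_upwards [hit.eventually hr, hζ.eventually (hH.eventually_eq (S := S) hz.1)] with u hu hu'
    funext c
    have h := hu' c
    rw [hu] at h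
    simpa [i, sub_left_inj] using h.symm
  · filter_upwards [mem_nhdsWithin_of_mem_nhds hl, eventually_logMonomial_inl_eq_zero hz α,
      mem_nhdsWithin_of_mem_nhds (hH.eventually_eq (S := S) hz.1)] with w hw he hc
    have h : i (H w) = logMonomial (gluingMatrix q S α) z w := by
      funext s
      rcases s with e | c
      · simp [i, he]
      · simp [i, hc]
    rw [h, hw]

/-! ### The derivative of a chart -/

variable {ζ : (T.Cusp → ℂ) → Fin n → ℂ}

theorem IsHolonomyChart.tendsto (hζ : IsHolonomyChart q S z H ζ) :
    Tendsto ζ (𝓝 (H z)) (𝓝 z) := by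
  have := hζ.holomorphic.self_of_nhds.continuousAt.tendsto
  rwa [hζ.base] at this

/-- The chain rule for the composition of a chart with logarithms of monomials. -/
theorem IsHolonomyChart.hasFDerivAt_logMonomial {ι : Type*} [Fintype ι]
    (hζ : IsHolonomyChart q S z H ζ)
    (hz : ∀ t, z t ≠ 0 ∧ z t ≠ 1) (a : Fin 3 → Matrix ι (Fin n) ℤ) (i : ι) :
    HasFDerivAt (fun u => logMonomial a z (ζ u) i)
      ((ContinuousLinearMap.proj i : (ι → ℂ) →L[ℂ] ℂ).comp
        ((LinearMap.toContinuousLinearMap (logJacobian a z).mulVecLin).comp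
          (fderiv ℂ ζ (H z)))) (H z) := by
  have h1 := OneLoop.hasFDerivAt_logMonomial a hz
  rw [← hζ.base] at h1
  have h2 := h1.comp (H z) hζ.holomorphic.self_of_nhds.hasFDerivAt
  rw [hζ.base] at h2
  exact hasFDerivAt_pi'.1 h2 i

/-- The Jacobian matrix of a chart. -/
noncomputable def chartJacobian (z : Fin n → ℂ) (H : (Fin n → ℂ) → T.Cusp → ℂ)
    (ζ : (T.Cusp → ℂ) → Fin n → ℂ) : Matrix (Fin n) T.Cusp ℂ :=
  Matrix.of fun t c => fderiv ℂ ζ (H z) (Pi.single c 1) t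

theorem IsHolonomyChart.logJacobian_mul {ι : Type*} [Fintype ι]
    (hζ : IsHolonomyChart q S z H ζ)
    (hz : ∀ t, z t ≠ 0 ∧ z t ≠ 1) (a : Fin 3 → Matrix ι (Fin n) ℤ) (i : ι) (c : T.Cusp) :
    (logJacobian a z * chartJacobian z H ζ) i c =
      fderiv ℂ (fun u => logMonomial a z (ζ u) i) (H z) (Pi.single c 1) := by
  rw [(hζ.hasFDerivAt_logMonomial hz a i).fderiv]
  rfl

/-- Along the chart the edge logarithms are constantly `0`, and the logarithmic holonomies of `α`
are the coordinates themselves up to constants. -/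
theorem IsHolonomyChart.logJacobian_mul_eq_fromRows (hζ : IsHolonomyChart q S z H ζ)
    (hz : z ∈ gluingVariety T q S) (hH : IsLogHolonomy q α z H) :
    logJacobian (gluingMatrix q S α) z * chartJacobian z H ζ =
      Matrix.fromRows (0 : Matrix S T.Cusp ℂ) (1 : Matrix T.Cusp T.Cusp ℂ) := by
  ext s c
  rw [hζ.logJacobian_mul hz.1]
  rcases s with e | d
  · have h : (fun u => logMonomial (gluingMatrix q S α) z (ζ u) (Sum.inl e)) =ᶠ[𝓝 (H z)]
        fun _ => 0 := by
      have ht : Tendsto ζ (𝓝 (H z)) (𝓝[gluingVariety T q S] z) :=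
        tendsto_nhdsWithin_iff.2 ⟨hζ.tendsto, hζ.mem⟩
      filter_upwards [ht.eventually (eventually_logMonomial_inl_eq_zero hz α)] with u hu
      exact hu e
    rw [h.fderiv_eq]
    simp
  · have h : (fun u => logMonomial (gluingMatrix q S α) z (ζ u) (Sum.inr d)) =ᶠ[𝓝 (H z)]
        fun u => u d - H z d := by
      filter_upwards [hζ.tendsto.eventually (hH.eventually_eq (S := S) hz.1), hζ.right_inv]
        with u hu hu'
      rw [hu d, hu']
    rw [h.fderiv_eq, ((hasFDerivAt_apply (𝕜 := ℂ) d (H z)).sub_const (H z d)).fderiv]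
    simp [Pi.single_apply, Matrix.one_apply]

/-- The chosen branch `H'` and the normalized logarithm differ by a constant near `z`, which
differentiation removes. -/
theorem IsHolonomyChart.logJacobian_mul_inr (hζ : IsHolonomyChart q S z H ζ)
    (hz : ∀ t, z t ≠ 0 ∧ z t ≠ 1) {α' : CurveSystem T} {H' : (Fin n → ℂ) → T.Cusp → ℂ}
    (hH' : IsLogHolonomy q α' z H') (d c : T.Cusp) :
    (logJacobian (gluingMatrix q S α') z * chartJacobian z H ζ) (Sum.inr d) c =
      holonomyJacobian z H H' ζ d c := by
  rw [hζ.logJacobian_mul hz]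
  have h : (fun u => logMonomial (gluingMatrix q S α') z (ζ u) (Sum.inr d)) =ᶠ[𝓝 (H z)]
      fun u => H' (ζ u) d - H' z d := by
    filter_upwards [hζ.tendsto.eventually (hH'.eventually_eq (S := S) hz)] with u hu
    exact hu d
  rw [h.fderiv_eq, fderiv_sub_const]
  rfl

end

end OneLoop

open OneLoop in
theorem theorem1p10 {n : ℕ} (T : IdealTriangulation n) (q : Fin n → Fin 3)
    (S : Finset T.Edge) (hS : IsEdgeBasis T.toFaceGluing q S)
    (f : Fin 3 → Fin n → ℤ) (hf : IsStrongFlattening q S f)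
    (r r' : Fin n ≃ S ⊕ T.Cusp)
    (z : Fin n → ℂ) (hz : z ∈ gluingVariety T.toFaceGluing q S)
    (α α' : CurveSystem T.toFaceGluing)
    (hτ : oneLoop q S f r α z ≠ 0)
    (H H' : (Fin n → ℂ) → T.Cusp → ℂ)
    (hH : IsLogHolonomy q α z H) (hH' : IsLogHolonomy q α' z H') :
    (∃ ζ, IsHolonomyChart q S z H ζ) ∧
    ∀ ζ, IsHolonomyChart q S z H ζ →
      (oneLoop q S f r' α' z = (holonomyJacobian z H H' ζ).det * oneLoop q S f r α z ∨
        oneLoop q S f r' α' z = -((holonomyJacobian z H H' ζ).det * oneLoop q S f r α z)) := by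
  have hz1 := hz.1
  have hdet : ((logJacobian (gluingMatrix q S α) z).submatrix r id).det ≠ 0 := by
    rw [oneLoop_eq f r α hz1] at hτ
    exact left_ne_zero_of_mul hτ
  obtain ⟨B, hDB, hBD⟩ := exists_inverse_of_det_submatrix_ne_zero _ r hdet
  refine ⟨exists_isHolonomyChart hz hH hDB hBD, fun ζ hζ => ?_⟩
  -- The edge rows do not involve the curves, so they agree by `rfl`. Both determinants use the
  -- numbering `r`; passing to `r'` costs only a sign.
  have key : ((logJacobian (gluingMatrix q S α') z).submatrix r id).det =
      (holonomyJacobian z H H' ζ).det *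
        ((logJacobian (gluingMatrix q S α) z).submatrix r id).det :=
    det_submatrix_eq_of_mul_eq r hdet (fun _ => rfl) (hζ.logJacobian_mul_eq_fromRows hz hH)
      (hζ.logJacobian_mul_inr hz1 hH')
  rw [oneLoop_eq f r α hz1, oneLoop_eq f r' α' hz1]
  rcases det_submatrix_eq_or_eq_neg (logJacobian (gluingMatrix q S α') z) r r' with h | h
  · left
    rw [h, key, mul_assoc]
  · right
    rw [h, key, neg_mul, mul_assoc]
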